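/- Let $f(x)=a_0x^n+a_1x^{n-1}+\cdots+a_n$ be a polynomial with real coefficients and $a_0>0$ which is stable, i.e. all of its complex zeros lie in the open left half-plane $\{z\in\mathbb{C}:\operatorname{Re} z<0\}$. Put $a_m=0$ for every integer $m<0$ and every integer $m>n$. Then for every even integer $M=2k$ with $1\le k\le\lfloor n/2\rfloor$ the infinite generalized Hurwitz matrix $$H_M(f)=\bigl(a_{Mj-i}\bigr)_{i,j=1}^{\infty}$$ is totally nonnegative, that is, all its minors (of every finite order $p$, with row indices $i_1<\cdots<i_p$ and column indices $j_1<\cdots<j_p$) are nonnegative. -/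

import Mathlib

open Polynomial

/-- A real polynomial is stable if all its complex zeros lie in the open left half-plane. -/
def IsStable (f : ℝ[X]) : Prop :=
  ∀ z : ℂ, aeval z f = 0 → z.re < 0

/-- For `f = a₀ xⁿ + a₁ xⁿ⁻¹ + ⋯ + aₙ` with `n = deg f`, the number `aₘ`, counted from the leading
coefficient, with the convention `aₘ = 0` for integers `m < 0` and `m > n`. -/
noncomputable def descCoeff (f : ℝ[X]) (m : ℤ) : ℝ :=
  if 0 ≤ m ∧ m ≤ (f.natDegree : ℤ) then f.coeff (f.natDegree - m.toNat) else 0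

/-- The generalized Hurwitz matrix `H_M(f) = (a_{Mj-i})`, with `i, j = 1, 2, 3, …`. -/
noncomputable def generalizedHurwitzMatrix (M : ℕ) (f : ℝ[X]) : Matrix ℕ+ ℕ+ ℝ :=
  Matrix.of fun i j => descCoeff f ((M : ℤ) * ((j : ℕ) : ℤ) - ((i : ℕ) : ℤ))

/-- A (possibly infinite) matrix is totally nonnegative if all its minors, of every finite order
`p`, with rows `i₁ < ⋯ < i_p` and columns `j₁ < ⋯ < j_p`, are nonnegative. -/
def IsTotallyNonnegative {m n : Type*} [Preorder m] [Preorder n] (A : Matrix m n ℝ) : Prop :=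
  ∀ (p : ℕ) (r : Fin p → m) (c : Fin p → n), StrictMono r → StrictMono c →
    0 ≤ (A.submatrix r c).det

/-! ### Total nonnegativity -/

/-! Column `j` of `H_{2k}` is column `kj` of `H_2`, so only the Hurwitz matrix `H_2` matters. Induct
on the degree: a Routh step lowers it by one and preserves stability (`IsStable.routhStep`), while
`H_2(f)` is a nonnegative bidiagonal matrix times `H_2` of the reduced polynomial
(`hurwitz_apply_eq_routhStep`). Such a factor preserves total nonnegativity. Stability survives by a
Julia-type inequality comparing `f(z)` with `(-1)ⁿ f(-z)`. -/

lemma IsTotallyNonnegative.of_two_term_rows {n : Type*} [Preorder n] {A B : Matrix ℕ+ n ℝ}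
    (hB : IsTotallyNonnegative B) (u v : ℕ+ → ℝ) (hu : ∀ i, 0 ≤ u i) (hv : ∀ i, 0 ≤ v i)
    (hA : ∀ i j, A i j = u i * B i j + v i * B (i + 1) j) : IsTotallyNonnegative A := by
  intro p r c hr hc
  let w : Fin p → Bool → ℝ := fun a b => if b then v (r a) else u (r a)
  let s : Fin p → Bool → ℕ+ := fun a b => if b then r a + 1 else r a
  have hrow : A.submatrix r c = fun a => ∑ b : Bool, w a b • (fun j => B (s a b) (c j)) := by
    ext a j
    simp [w, s, hA, add_comm]
  have hdet : (A.submatrix r c).det = ∑ φ : Fin p → Bool,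
      (∏ a, w a (φ a)) * (B.submatrix (fun a => s a (φ a)) c).det := by
    rw [hrow]
    change (Matrix.detRowAlternating (R := ℝ)).toMultilinearMap _ = _
    rw [MultilinearMap.map_sum]
    refine Finset.sum_congr rfl fun φ _ => ?_
    rw [MultilinearMap.map_smul_univ]
    rfl
  rw [hdet]
  refine Finset.sum_nonneg fun φ _ => mul_nonneg (Finset.prod_nonneg fun a _ => ?_) ?_
  · dsimp only [w]
    split_ifs
    exacts [hv _, hu _]
  -- Each term takes row `r a` or `r a + 1`, so the chosen rows stay weakly ordered: the determinant
  -- is a minor of `B`, or two rows coincide and it vanishes.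
  · have hmono : Monotone fun a => s a (φ a) := by
      intro a b hab
      rcases hab.eq_or_lt with rfl | hab
      · exact le_rfl
      · have h1 : r a + 1 ≤ r b := PNat.add_one_le_iff.2 (hr hab)
        have h2 : r b ≤ r b + 1 := (PNat.lt_add_right _ _).le
        have h3 : r a ≤ r b := (hr hab).le
        dsimp only [s]
        split_ifs
        exacts [h1.trans h2, h1, h3.trans h2, h3]
    by_cases hinj : Function.Injective fun a => s a (φ a)
    · exact hB p _ c (hmono.strictMono_of_injective hinj) hc
    · simp only [Function.Injective, not_forall] at hinj
      obtain ⟨a, b, hab, hne⟩ := hinj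
      refine (Matrix.det_zero_of_row_eq hne ?_).ge
      ext j
      simp only [Matrix.submatrix_apply]
      exact congrArg (fun x => B x (c j)) hab

lemma IsTotallyNonnegative.of_apply_eq_ite {m n : Type*} [LinearOrder m] [LinearOrder n]
    {A : Matrix m n ℝ} {t : ℝ} (ht : 0 ≤ t) (e : n → m) (he : StrictMono e)
    [∀ i j, Decidable (e j = i)] (hA : ∀ i j, A i j = if e j = i then t else 0) :
    IsTotallyNonnegative A := by
  intro p r c hr hc
  by_cases h : ∀ a, ∃ b, e (c b) = r a
  · choose σ hσ using h
    have hσm : StrictMono σ := by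
      intro a b hab
      have := hr hab
      rw [← hσ a, ← hσ b] at this
      exact hc.lt_iff_lt.1 (he.lt_iff_lt.1 this)
    -- A strictly increasing self-map of `Fin p` is the identity.
    have hid : ∀ a, σ a = a := fun a => le_antisymm hσm.apply_le hσm.le_apply
    have hdiag : A.submatrix r c = Matrix.diagonal fun _ => t := by
      ext a b
      have hra : r a = e (c a) := by rw [← hσ a, hid]
      simp only [Matrix.submatrix_apply, hA, hra, he.injective.eq_iff, hc.injective.eq_iff,
        Matrix.diagonal_apply, eq_comm]
    rw [hdiag, Matrix.det_diagonal]
    exact Finset.prod_nonneg fun _ _ => ht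
  · push Not at h
    obtain ⟨a, ha⟩ := h
    refine (Matrix.det_eq_zero_of_row_eq_zero a fun b => ?_).ge
    simp [hA, ha b]

/-! ### The Julia inequality for a product of half-plane Blaschke factors -/

lemma mul_add_sq_le_add_mul_add {x a b s t U V : ℝ} (hx : 0 ≤ x)
    (hs : 0 ≤ s) (ht : 0 ≤ t) (hU : 0 ≤ U) (hV : 0 ≤ V)
    (h₁ : x * a ^ 2 ≤ s * U) (h₂ : x * b ^ 2 ≤ t * V) :
    x * (a + b) ^ 2 ≤ (s + t) * (U + V) := by
  have key : 2 * (x * a * b) ≤ s * V + t * U := by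
    refine le_of_sq_le_sq ?_ (by positivity)
    have := mul_le_mul h₁ h₂ (by positivity) (by positivity)
    nlinarith [sq_nonneg (s * V - t * U)]
  nlinarith

/-- Induction on the factors: both `F - G` and `‖F‖² - ‖G‖²` split into an old part and the
contribution of the new root. `mul_add_sq_le_add_mul_add` adds the two bounds; the one for the new
root is an equality. -/
lemma normSq_prod_sub_prod_le (z : ℂ) (hz : 0 ≤ z.re) (S : Multiset ℂ)
    (hS : ∀ r ∈ S, r.re ≤ 0) :
    0 ≤ -S.sum.re ∧
    ‖(S.map fun r => z + (starRingEnd ℂ) r).prod‖ ^ 2 ≤ ‖(S.map fun r => z - r).prod‖ ^ 2 ∧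
    z.re * ‖(S.map fun r => z - r).prod - (S.map fun r => z + (starRingEnd ℂ) r).prod‖ ^ 2 ≤
      -S.sum.re * (‖(S.map fun r => z - r).prod‖ ^ 2 -
        ‖(S.map fun r => z + (starRingEnd ℂ) r).prod‖ ^ 2) := by
  induction S using Multiset.induction with
  | empty => simp
  | cons r S ih =>
    obtain ⟨h0, h1, h2⟩ := ih fun q hq => hS q (Multiset.mem_cons_of_mem hq)
    have hr : r.re ≤ 0 := hS r (Multiset.mem_cons_self r S)
    simp only [Multiset.map_cons, Multiset.prod_cons, Multiset.sum_cons, Complex.add_re]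
    set F := (S.map fun r => z - r).prod
    set G := (S.map fun r => z + (starRingEnd ℂ) r).prod
    have hfac : ‖z - r‖ ^ 2 = ‖z + (starRingEnd ℂ) r‖ ^ 2 + 4 * (z.re * -r.re) := by
      simp only [Complex.sq_norm, Complex.normSq_apply, Complex.sub_re, Complex.sub_im,
        Complex.add_re, Complex.add_im, Complex.conj_re, Complex.conj_im]
      ring
    have hzr : 0 ≤ z.re * -r.re := mul_nonneg hz (by linarith)
    have hconj : r + (starRingEnd ℂ) r = ((2 * r.re : ℝ) : ℂ) := Complex.add_conj r
    have hsplit : (z - r) * F - (z + (starRingEnd ℂ) r) * G =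
        (z - r) * (F - G) + ((2 * -r.re : ℝ) : ℂ) * G := by
      have : ((2 * -r.re : ℝ) : ℂ) = -(r + (starRingEnd ℂ) r) := by
        rw [hconj]; push_cast; ring
      rw [this]; ring
    have hdiff : ‖z - r‖ ^ 2 * ‖F‖ ^ 2 - ‖z + (starRingEnd ℂ) r‖ ^ 2 * ‖G‖ ^ 2 =
        ‖z - r‖ ^ 2 * (‖F‖ ^ 2 - ‖G‖ ^ 2) + 4 * (z.re * -r.re) * ‖G‖ ^ 2 := by
      rw [hfac]; ring
    have hU : 0 ≤ ‖z - r‖ ^ 2 * (‖F‖ ^ 2 - ‖G‖ ^ 2) :=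
      mul_nonneg (sq_nonneg _) (sub_nonneg.2 h1)
    have hV : 0 ≤ 4 * (z.re * -r.re) * ‖G‖ ^ 2 := by positivity
    refine ⟨by linarith, ?_, ?_⟩
    · rw [norm_mul, norm_mul, mul_pow, mul_pow]
      linarith
    · have hnorm : ‖(z - r) * F - (z + (starRingEnd ℂ) r) * G‖ ≤
          ‖z - r‖ * ‖F - G‖ + 2 * -r.re * ‖G‖ := by
        rw [hsplit]
        refine (norm_add_le _ _).trans_eq ?_
        rw [norm_mul, norm_mul, Complex.norm_real, Real.norm_of_nonneg (by linarith)]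
      calc z.re * ‖(z - r) * F - (z + (starRingEnd ℂ) r) * G‖ ^ 2
          ≤ z.re * (‖z - r‖ * ‖F - G‖ + 2 * -r.re * ‖G‖) ^ 2 := by gcongr
        _ ≤ (-S.sum.re + -r.re) * (‖z - r‖ ^ 2 * (‖F‖ ^ 2 - ‖G‖ ^ 2) +
              4 * (z.re * -r.re) * ‖G‖ ^ 2) := by
            refine mul_add_sq_le_add_mul_add hz h0 (by linarith) hU hV ?_ (by nlinarith)
            have := mul_le_mul_of_nonneg_left h2 (sq_nonneg ‖z - r‖)
            nlinarith
        _ = _ := by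
            rw [norm_mul, norm_mul, mul_pow, mul_pow, ← hdiff]
            ring

/-! ### Stable polynomials -/

lemma card_aroots (f : ℝ[X]) : Multiset.card (f.aroots ℂ) = f.natDegree := by
  rw [aroots, ← (IsAlgClosed.splits _).natDegree_eq_card_roots, natDegree_map]

lemma aeval_eq_prod_aroots (f : ℝ[X]) (z : ℂ) :
    aeval z f = f.leadingCoeff * ((f.aroots ℂ).map fun r => z - r).prod := by
  rw [← eval_map_algebraMap, (IsAlgClosed.splits (f.map (algebraMap ℝ ℂ))).eval_eq_prod_roots,
    leadingCoeff_map]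
  rfl

lemma nextCoeff_eq_re_sum_aroots (f : ℝ[X]) :
    f.nextCoeff = f.leadingCoeff * -(f.aroots ℂ).sum.re := by
  have h := (IsAlgClosed.splits (f.map (algebraMap ℝ ℂ))).nextCoeff_eq_neg_sum_roots_mul_leadingCoeff
  rw [nextCoeff_map_eq, leadingCoeff_map] at h
  have := congrArg Complex.re h
  simpa [aroots] using this

/-- As `f` is real, conjugating `f(-z̄)` turns `(-1)ⁿ f(-z)` into `a₀ ∏ (z + r̄)`; also `a₁ = -a₀ ∑
Re r`. -/
lemma IsStable.normSq_sub_le {f : ℝ[X]} (hf : IsStable f) (ha : 0 < f.leadingCoeff) {z : ℂ}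
    (hz : 0 ≤ z.re) :
    z.re * f.leadingCoeff * ‖aeval z f - (-1) ^ f.natDegree * aeval (-z) f‖ ^ 2 ≤
      f.nextCoeff * (‖aeval z f‖ ^ 2 - ‖(-1) ^ f.natDegree * aeval (-z) f‖ ^ 2) := by
  set S := f.aroots ℂ
  have hF : aeval z f = f.leadingCoeff * (S.map fun r => z - r).prod := aeval_eq_prod_aroots f z
  have hG : (-1) ^ f.natDegree * aeval (-z) f =
      f.leadingCoeff * (S.map fun r => z + (starRingEnd ℂ) r).prod := by
    have hconj : aeval (-z) f = (starRingEnd ℂ) (aeval (-(starRingEnd ℂ) z) f) := by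
      rw [← map_neg, aeval_conj, Complex.conj_conj]
    have hneg : (S.map fun r => -(starRingEnd ℂ) z - r).prod =
        (-1) ^ f.natDegree * (S.map fun r => (starRingEnd ℂ) z + r).prod := by
      rw [← card_aroots f, ← Multiset.card_map (fun r => (starRingEnd ℂ) z + r) S,
        ← Multiset.prod_map_neg, Multiset.map_map]
      congr 2
      ext r
      simp [sub_eq_add_neg, add_comm]
    rw [hconj, aeval_eq_prod_aroots, hneg, map_mul, map_mul, Complex.conj_ofReal, map_pow, map_neg,
      map_one, map_multiset_prod, Multiset.map_map, mul_left_comm, ← mul_assoc ((-1) ^ _), ← mul_pow]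
    simp
  have hS : ∀ r ∈ S, r.re ≤ 0 := fun r hr => (hf r ((mem_aroots.1 hr).2)).le
  obtain ⟨-, -, h⟩ := normSq_prod_sub_prod_le z hz S hS
  rw [hF, hG, nextCoeff_eq_re_sum_aroots, ← mul_sub]
  simp only [norm_mul, mul_pow, Complex.norm_real, Real.norm_eq_abs, sq_abs]
  have := mul_le_mul_of_nonneg_left h (show 0 ≤ f.leadingCoeff ^ 2 * f.leadingCoeff by positivity)
  linear_combination this

lemma IsStable.nextCoeff_pos {f : ℝ[X]} (hf : IsStable f) (ha : 0 < f.leadingCoeff)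
    (hn : f.natDegree ≠ 0) : 0 < f.nextCoeff := by
  rw [nextCoeff_eq_re_sum_aroots]
  have hne : f.aroots ℂ ≠ 0 := by
    rw [← Multiset.card_pos, card_aroots f]
    omega
  refine mul_pos ha (neg_pos.2 ?_)
  have hre : (f.aroots ℂ).sum.re = ((f.aroots ℂ).map Complex.re).sum :=
    map_multiset_sum Complex.reAddGroupHom _
  rw [hre]
  have := Multiset.sum_lt_sum_of_nonempty (g := fun _ => (0 : ℝ)) hne
    fun r hr => hf r (mem_aroots.1 hr).2
  simpa using this

/-! ### The Routh step -/

/-- The part of `f` made of the monomials whose degree has the parity of `deg f - 1`. -/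
noncomputable def routhOdd (f : ℝ[X]) : ℝ[X] :=
  C (1 / 2) * (f - C ((-1) ^ f.natDegree) * f.comp (-X))

/-- One step of Routh's algorithm: `f - (a₀ / a₁) x (a₁ xⁿ⁻¹ + a₃ xⁿ⁻³ + ⋯)`. -/
noncomputable def routhStep (f : ℝ[X]) : ℝ[X] :=
  f - C (f.leadingCoeff / f.nextCoeff) * (X * routhOdd f)

lemma coeff_routhOdd (f : ℝ[X]) (l : ℕ) :
    (routhOdd f).coeff l = if Even (f.natDegree + l) then 0 else f.coeff l := by
  have h : (f.comp (-X)).coeff l = (-1) ^ l * f.coeff l := by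
    have := comp_C_mul_X_coeff (p := f) (r := (-1 : ℝ)) (n := l)
    rw [C_neg, C_1, neg_one_mul] at this
    rw [this, mul_comm]
  rw [routhOdd, coeff_C_mul, coeff_sub, coeff_C_mul, h, ← mul_assoc, ← pow_add]
  split_ifs with hl
  · rw [hl.neg_one_pow]; ring
  · rw [(Nat.not_even_iff_odd.1 hl).neg_one_pow]; ring

lemma coeff_routhStep_zero (f : ℝ[X]) : (routhStep f).coeff 0 = f.coeff 0 := by
  simp [routhStep]

lemma coeff_routhStep_succ (f : ℝ[X]) (l : ℕ) :
    (routhStep f).coeff (l + 1) = f.coeff (l + 1) -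
      f.leadingCoeff / f.nextCoeff * if Even (f.natDegree + l) then 0 else f.coeff l := by
  rw [routhStep, coeff_sub, coeff_C_mul, coeff_X_mul, coeff_routhOdd]

/-- `X * routhOdd f` has only degrees of the parity of `n`: it cancels the leading term and leaves
`a₁` untouched. -/
lemma natDegree_routhStep_add_one {f : ℝ[X]} (hn : f.natDegree ≠ 0) (h1 : f.nextCoeff ≠ 0) :
    (routhStep f).coeff (f.natDegree - 1) = f.nextCoeff ∧
      (routhStep f).natDegree + 1 = f.natDegree := by
  have hnc : f.nextCoeff = f.coeff (f.natDegree - 1) := nextCoeff_of_natDegree_pos (by omega)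
  obtain ⟨d, hd⟩ := Nat.exists_eq_succ_of_ne_zero hn
  rw [hd] at hnc ⊢
  simp only [Nat.succ_eq_add_one, Nat.add_sub_cancel] at hnc ⊢
  have htop : (routhStep f).coeff d = f.nextCoeff := by
    cases d with
    | zero => rw [coeff_routhStep_zero, hnc]
    | succ d =>
      rw [coeff_routhStep_succ, hd, if_pos ⟨d + 1, by omega⟩, mul_zero, sub_zero, hnc]
  have hle : (routhStep f).natDegree ≤ d := by
    refine natDegree_le_iff_coeff_eq_zero.2 fun N hN => ?_
    obtain ⟨l, rfl⟩ : ∃ l, N = l + 1 := ⟨N - 1, by omega⟩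
    rw [coeff_routhStep_succ]
    rcases (show d ≤ l by omega).eq_or_lt with rfl | hl
    · rw [hd, if_neg (by rw [Nat.even_iff]; omega), ← hnc, div_mul_cancel₀ _ h1, leadingCoeff, hd,
        sub_self]
    · rw [coeff_eq_zero_of_natDegree_lt (by omega)]
      split_ifs with he
      · simp
      · rcases (show d + 1 ≤ l from hl).eq_or_lt with rfl | hl'
        · exact absurd (by rw [hd]; exact ⟨_, rfl⟩) he
        · rw [coeff_eq_zero_of_natDegree_lt (by omega)]; simp
  refine ⟨htop, ?_⟩
  rw [natDegree_eq_of_le_of_coeff_ne_zero hle (htop ▸ h1)]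

lemma descCoeff_natDegree_sub (f : ℝ[X]) {m : ℤ} {l : ℕ} (h : m = f.natDegree - l) :
    descCoeff f m = f.coeff l := by
  subst h
  rw [descCoeff]
  split_ifs with hl
  · congr 1
    omega
  · rw [coeff_eq_zero_of_natDegree_lt (by omega)]

lemma descCoeff_of_natDegree_lt (f : ℝ[X]) {m : ℤ} (h : (f.natDegree : ℤ) < m) :
    descCoeff f m = 0 :=
  if_neg (by omega)

lemma descCoeff_routhStep {f : ℝ[X]} (hn : f.natDegree ≠ 0) (h1 : f.nextCoeff ≠ 0) (m : ℤ) :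
    descCoeff (routhStep f) m = descCoeff f (m + 1) -
      f.leadingCoeff / f.nextCoeff * if Even m then 0 else descCoeff f (m + 2) := by
  obtain ⟨-, hdeg⟩ := natDegree_routhStep_add_one hn h1
  rcases lt_or_ge ((routhStep f).natDegree : ℤ) m with hm | hm
  · rw [descCoeff_of_natDegree_lt _ hm, descCoeff_of_natDegree_lt _ (by omega),
      descCoeff_of_natDegree_lt _ (by omega)]
    simp
  obtain ⟨l, hl⟩ : ∃ l : ℕ, m = (routhStep f).natDegree - l :=
    ⟨((routhStep f).natDegree - m).toNat, by omega⟩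
  rw [descCoeff_natDegree_sub _ hl, descCoeff_natDegree_sub f (l := l) (by omega)]
  cases l with
  | zero =>
    -- Here `m + 2 = n + 1`, so the zero convention removes the correction.
    rw [coeff_routhStep_zero, descCoeff_of_natDegree_lt f (by omega)]
    simp
  | succ l =>
    rw [coeff_routhStep_succ, descCoeff_natDegree_sub f (l := l) (by omega)]
    congr 3
    rw [Nat.even_iff, Int.even_iff, eq_iff_iff]
    omega

lemma IsStable.routhStep {f : ℝ[X]} (hf : IsStable f) (ha : 0 < f.leadingCoeff)
    (hn : f.natDegree ≠ 0) : IsStable (routhStep f) := by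
  intro z hz
  by_contra! hre
  have h1 := hf.nextCoeff_pos ha hn
  have hF : aeval z f ≠ 0 := fun h => hre.not_gt (hf z h)
  have hJ := hf.normSq_sub_le ha hre
  set F := aeval z f
  set G := (-1) ^ f.natDegree * aeval (-z) f with hG
  set c : ℝ := f.leadingCoeff / f.nextCoeff with hc
  have hc0 : 0 < c := div_pos ha h1
  have hQ : aeval z (_root_.routhStep f) = F - c * (z * (1 / 2 * (F - G))) := by
    simp [_root_.routhStep, routhOdd, aeval_comp, F, hG, hc]
  rw [hQ] at hz
  -- A zero with `Re z ≥ 0` fixes `F - G` and `G` in terms of `F`. The Julia inequality times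
  -- `c²‖z‖²`, which avoids dividing by `z`, then forces `4a₁‖F‖² ≤ 0`.
  have e1 : (c * z) * (F - G) = 2 * F := by linear_combination -2 * hz
  have e2 : (c * z) * G = (c * z - 2) * F := by linear_combination 2 * hz
  have n1 : c ^ 2 * ‖z‖ ^ 2 * ‖F - G‖ ^ 2 = 4 * ‖F‖ ^ 2 := by
    have := congrArg (fun w => ‖w‖ ^ 2) e1
    simp only [norm_mul, mul_pow, Complex.norm_real, Real.norm_eq_abs, sq_abs] at this
    rw [this]
    norm_num
  have n2 : c ^ 2 * ‖z‖ ^ 2 * ‖G‖ ^ 2 = (c ^ 2 * ‖z‖ ^ 2 - 4 * c * z.re + 4) * ‖F‖ ^ 2 := by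
    have := congrArg (fun w => ‖w‖ ^ 2) e2
    simp only [norm_mul, mul_pow, Complex.norm_real, Real.norm_eq_abs, sq_abs] at this
    rw [this]
    congr 1
    simp only [Complex.sq_norm, Complex.normSq_apply, Complex.sub_re, Complex.sub_im,
      Complex.mul_re, Complex.mul_im, Complex.ofReal_re, Complex.ofReal_im, Complex.re_ofNat,
      Complex.im_ofNat]
    ring
  have hlc : f.leadingCoeff = c * f.nextCoeff := by rw [hc]; field_simp
  rw [hlc] at hJ
  have hFpos : 0 < ‖F‖ ^ 2 := by positivity
  have hmul := mul_le_mul_of_nonneg_left hJ (show 0 ≤ c ^ 2 * ‖z‖ ^ 2 by positivity)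
  have : f.nextCoeff * (4 * ‖F‖ ^ 2) ≤ 0 := by
    linear_combination hmul + (z.re * c * f.nextCoeff) * -n1 + f.nextCoeff * -n2
  nlinarith [mul_pos h1 hFpos]

/-! ### The Hurwitz matrix -/

/-- With `b` the reduced coefficients and `c = a₀ / a₁`, `b_m = a_{m+1}` for even `m`, so the term
`c * a_{m+2}` subtracted at odd `m` is `c * b_{m+1}`, an entry one row up. -/
lemma hurwitz_apply_eq_routhStep {f : ℝ[X]} (hn : f.natDegree ≠ 0) (h1 : f.nextCoeff ≠ 0)
    (i j : ℕ+) :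
    generalizedHurwitzMatrix 2 f i j =
      (if Even (i : ℕ) then f.leadingCoeff / f.nextCoeff else 0) *
          generalizedHurwitzMatrix 2 (routhStep f) i j +
        1 * generalizedHurwitzMatrix 2 (routhStep f) (i + 1) j := by
  simp only [generalizedHurwitzMatrix, Matrix.of_apply, descCoeff_routhStep hn h1, PNat.add_coe,
    PNat.one_coe]
  push_cast
  have e1 : (2 * (j : ℤ) - ((i : ℤ) + 1) + 1) = 2 * j - i := by ring
  have e2 : (2 * (j : ℤ) - ((i : ℤ) + 1) + 2) = 2 * j - i + 1 := by ring
  rw [e1, e2]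
  by_cases hi : Even (i : ℕ)
  · have p1 : Even (2 * (j : ℤ) - i) := by rw [Nat.even_iff] at hi; rw [Int.even_iff]; omega
    have p2 : ¬ Even (2 * (j : ℤ) - (i + 1)) := by
      rw [Nat.even_iff] at hi; rw [Int.even_iff]; omega
    rw [if_pos hi, if_pos p1, if_neg p2]
    ring
  · have p2 : Even (2 * (j : ℤ) - (i + 1)) := by
      rw [Nat.even_iff] at hi; rw [Int.even_iff]; omega
    rw [if_neg hi, if_pos p2]
    ring

lemma IsStable.isTotallyNonnegative_hurwitz {f : ℝ[X]} (hf : IsStable f)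
    (ha : 0 < f.leadingCoeff) : IsTotallyNonnegative (generalizedHurwitzMatrix 2 f) := by
  obtain ⟨n, hn⟩ : ∃ n, f.natDegree = n := ⟨_, rfl⟩
  induction n generalizing f with
  | zero =>
    -- For constant `f`, only the entries with `i = 2j` are nonzero.
    refine .of_apply_eq_ite ha.le (fun j => 2 * j) (fun a b h => mul_lt_mul_right h 2)
      fun i j => ?_
    simp only [generalizedHurwitzMatrix, Matrix.of_apply]
    split_ifs with h
    · rw [descCoeff_natDegree_sub f (l := 0), leadingCoeff, hn]
      rw [hn, ← h]
      push_cast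
      ring
    · rw [descCoeff, if_neg]
      rintro ⟨h₁, h₂⟩
      refine h (PNat.eq ?_)
      rw [PNat.mul_coe]
      push_cast at *
      rw [hn] at h₂
      push_cast at h₂
      omega
  | succ n ih =>
    have hn0 : f.natDegree ≠ 0 := by omega
    have h1 := hf.nextCoeff_pos ha hn0
    obtain ⟨htop, hdeg⟩ := natDegree_routhStep_add_one hn0 h1.ne'
    have hlead : (_root_.routhStep f).leadingCoeff = f.nextCoeff := by
      rw [← htop, leadingCoeff, ← hdeg, Nat.add_sub_cancel]
    refine (ih (hf.routhStep ha hn0) (hlead ▸ h1) (by omega)).of_two_term_rows _ _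
      (fun i => ?_) (fun i => zero_le_one) (hurwitz_apply_eq_routhStep hn0 h1.ne')
    split_ifs
    exacts [(div_pos ha h1).le, le_rfl]

theorem mainTheorem5 (f : ℝ[X]) (ha₀ : 0 < f.leadingCoeff) (hf : IsStable f)
    (k : ℕ) (hk₁ : 1 ≤ k) (hk₂ : k ≤ f.natDegree / 2) :
    IsTotallyNonnegative (generalizedHurwitzMatrix (2 * k) f) := by
  obtain ⟨q, rfl⟩ : ∃ q : ℕ+, (q : ℕ) = k := ⟨⟨k, hk₁⟩, rfl⟩
  intro p r c hr hc
  have h := hf.isTotallyNonnegative_hurwitz ha₀ p r (fun a => q * c a) hr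
    (fun a b hab => mul_lt_mul_right (hc hab) _)
  convert h using 2
  ext a b
  simp only [Matrix.submatrix_apply, generalizedHurwitzMatrix, Matrix.of_apply, PNat.mul_coe]
  push_cast
  rw [mul_assoc]
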